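/- **Lemma 3.3.** Let $X$ be a finite set and let $\mathcal F$ be a family of subsets of $X$. In the $(1:q)$ Maker–Breaker game with board $X$ and winning sets $\mathcal F$, Breaker and Maker alternately claim previously unclaimed elements of $X$, Breaker going first; in each turn Breaker claims $q$ elements (or all remaining ones, if fewer than $q$ are left) and Maker claims one element (if any is left). Maker wins as soon as he has claimed all elements of some member of $\mathcal F$. Let $\beta > 0$ and $0 < \gamma < 1/8$ be real numbers such that $\beta + 2\gamma < 1$. Then there are a function $f : \mathbb{N} \to \mathbb{R}$ with $f(k) = o(k)$ as $k \to \infty$ and an integer $k_0$, both depending only on $\beta$ and $\gamma$, such that the following holds for every $k \ge k_0$ and every integer $0 \le q \le k^{\gamma}$. Let $G = (V, E)$ be a simple graph on $k$ vertices with minimum degree at least $k - k^{\beta}$, and let $a, b \in V$ be two distinct vertices. Then, in the $(1:q)$ game with board $E$ whose winning sets are the edge sets of the Hamilton paths of $G$ with endpoints $a$ and $b$, Maker has a strategy that guarantees, against every play of Breaker, that he wins within at most $k + f(k)$ of his own moves. -/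

import Mathlib

open Asymptotics

namespace MakerBreaker

variable {α : Type*} [DecidableEq α]

/-- `S` is a legal move for a player of bias `m` when `free` is the set of unclaimed board elements:
the player claims exactly `m` free elements, or all of them if fewer than `m` are left. -/
def IsMove (free : Finset α) (m : ℕ) (S : Finset α) : Prop :=
  S ⊆ free ∧ S.card = min m free.card

/-- Everything that Breaker has claimed, given the list of his moves. -/
def breakerSet : List (Finset α) → Finset α
  | [] => ∅
  | S :: h => breakerSet h ∪ S

/-- A strategy of Maker, who moves second, is a function `σ` from the (nonempty) list of all moves
made by Breaker so far, the latest one first, to Maker's reply. (The earlier moves of Maker are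
determined by `σ` and this list.) `makerSet σ h` is everything that Maker has claimed by following
`σ` when `h` is the list of Breaker's moves and Maker has replied to each of them. -/
def makerSet (σ : List (Finset α) → Finset α) : List (Finset α) → Finset α
  | [] => ∅
  | S :: h => makerSet σ h ∪ σ (S :: h)

/-- `h` (latest move first) is a possible list of moves of Breaker, who moves first and has bias
`q`, in the game on the board `X` in which Maker plays according to `σ`. -/
def BreakerPlay (X : Finset α) (q : ℕ) (σ : List (Finset α) → Finset α) :
    List (Finset α) → Prop
  | [] => True
  | S :: h => BreakerPlay X q σ h ∧ IsMove (X \ (makerSet σ h ∪ breakerSet h)) q S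

/-- Every reply of `σ` in the `(p : q)` game on the board `X` is a legal move of Maker. -/
def IsMakerStrategy (X : Finset α) (p q : ℕ) (σ : List (Finset α) → Finset α) : Prop :=
  ∀ (S : Finset α) (h : List (Finset α)), BreakerPlay X q σ (S :: h) →
    IsMove (X \ (makerSet σ h ∪ breakerSet (S :: h))) p (σ (S :: h))

/-- In the `(p : q)` Maker-Breaker game with board `X` and family of winning sets `F`, Breaker going
first, Maker has a strategy which ensures, against every play of Breaker, that Maker occupies all
elements of some winning set after at most `t` of his moves. (Once the board is exhausted, the only
legal move is the empty one, so every play extends to any number of rounds.) -/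
def MakerWinsWithin (X : Finset α) (F : Set (Finset α)) (p q t : ℕ) : Prop :=
  ∃ σ : List (Finset α) → Finset α, IsMakerStrategy X p q σ ∧
    ∀ h : List (Finset α), BreakerPlay X q σ h → h.length = t →
      ∃ W ∈ F, W ⊆ makerSet σ h

/-- The edge sets of the Hamilton paths of `G` with endpoints `a` and `b`. -/
def hamPathSets {V : Type*} [DecidableEq V] (G : SimpleGraph V) (a b : V) :
    Set (Finset (Sym2 V)) :=
  {W | ∃ P : G.Walk a b, P.IsHamiltonian ∧ W = P.edges.toFinset}

end MakerBreaker

/-!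
Order all vertices in a sequence that starts at `a` and ends at `b` (or the reverse), and call a
consecutive pair a *gap* if Maker does not own it. A sequence without gaps is the Hamilton path that
Maker wants. He starts with an arbitrary sequence and removes gaps by exchanges known from local
search for the travelling salesman problem. The gap endpoints never include a new vertex, so Maker
only has to keep Breaker's degree small at the current ones.

*Many gaps.* If `v` and `u` are both followed by gaps, then owning `vu` lets Maker reverse the
segment between them and lose one gap (`IsTour.two_opt`, `IsTour.exists_join`), so each of these
rounds removes a gap. Maker serves a gap endpoint `v` at which Breaker has degree at least `d`
whenever there is one. Every such move adds an edge to those of Maker's edges that touch a vertex of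
Breaker degree at least `d`. There are few such vertices, because Breaker owns at most `qk` edges,
and Maker's graph has degree at most 2 at each of them; so these moves are few, and between them
Breaker cannot raise the degree of a gap endpoint far above `d`
(`card_heavyEdges_le`, `canWin_of_many_gaps`).

*Few gaps.* A gap `vw` is closed within `q + 3` rounds (`canWin_of_close_gap`). Maker claims `q + 1`
edges `v x` to vertices `x` further along the sequence, whose successors `y` have small Breaker
degree. Then he claims one edge `w p` with `p` still further along, such that the successor `p'` of
`p` has free edges to all the `y`. Breaker cannot block all `q + 1` edges `y p'`, and with `v x`,
`w p` and `y p'` Maker closes the gap by reversing two adjacent segments (`IsTour.three_opt`).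

With `d` about `k ^ (1 - 3γ)`, the second stage starts with `m = O(k ^ max β (1 - 3γ))` gaps. It
lasts `m (q + 3)` rounds, which is `o(k)`, and in it Breaker claims only `q m (q + 3) = o(k)` edges,
by `β + 2γ < 1`.
-/

namespace MakerBreaker

/-! ### Backward induction for the game -/

section Game

variable {α : Type*}

lemma exists_isMove (Y : Finset α) (m : ℕ) : ∃ R, IsMove Y m R := by
  obtain ⟨R, hR, hc⟩ := Finset.exists_subset_card_eq (min_le_right m Y.card)
  exact ⟨R, hR, hc⟩

variable [DecidableEq α]

/-- A position, with Breaker to move, from which Maker can own a winning set after `t` rounds.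
Compared with the game itself, Breaker may claim fewer than `q` elements or claim elements again, and
Maker may pass or claim an element that he already owns. So `M` need only be a part of what Maker owns. -/
def CanWin (X : Finset α) (F : Set (Finset α)) (q : ℕ) : ℕ → Finset α → Finset α → Prop
  | 0, M, _ => ∃ W ∈ F, W ⊆ M
  | t + 1, M, B => ∀ S ⊆ X, Disjoint S M → S.card ≤ q →
      ∃ T ⊆ X, Disjoint T (B ∪ S) ∧ T.card ≤ 1 ∧ CanWin X F q t (M ∪ T) (B ∪ S)

variable {X : Finset α} {F : Set (Finset α)} {q : ℕ}

lemma canWin_of_subset {M W : Finset α} (hW : W ∈ F) (hWM : W ⊆ M) (t : ℕ) (B : Finset α) :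
    CanWin X F q t M B := by
  induction t generalizing B with
  | zero => exact ⟨W, hW, hWM⟩
  | succ t ih =>
    intro S _ _ _
    exact ⟨∅, by simp, by simp, by simp, by simpa using ih (B ∪ S)⟩

lemma CanWin.succ {t : ℕ} {M B : Finset α} (h : CanWin X F q t M B) :
    CanWin X F q (t + 1) M B := by
  induction t generalizing M B with
  | zero =>
    obtain ⟨W, hW, hWM⟩ := h
    exact canWin_of_subset hW hWM _ _
  | succ t ih =>
    intro S hS hSM hSq
    obtain ⟨T, hT, hTB, hT1, hw⟩ := h S hS hSM hSq
    exact ⟨T, hT, hTB, hT1, ih hw⟩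

lemma CanWin.mono {t t' : ℕ} {M B : Finset α} (h : CanWin X F q t M B) (htt : t ≤ t') :
    CanWin X F q t' M B := by
  induction t', htt using Nat.le_induction with
  | base => exact h
  | succ n _ ih => exact ih.succ

lemma canWin_succ_of_forall_exists {t : ℕ} {M B : Finset α}
    (h : ∀ S ⊆ X, Disjoint S M → S.card ≤ q →
      ∃ e ∈ X \ (B ∪ S), CanWin X F q t (insert e M) (B ∪ S)) :
    CanWin X F q (t + 1) M B := by
  intro S hS hSM hSq
  obtain ⟨e, he, hw⟩ := h S hS hSM hSq
  rw [Finset.mem_sdiff] at he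
  refine ⟨{e}, by simpa using he.1, by simpa using he.2, by simp, ?_⟩
  rwa [Finset.union_comm, ← Finset.insert_eq]

/-- Maker can collect any `s` elements out of `(q + 1) * s` free ones, one per
round. -/
lemma canWin_collect {t : ℕ} (s : ℕ) {M B E : Finset α} (hEX : E ⊆ X) (hEB : Disjoint E B)
    (hcard : (q + 1) * s ≤ E.card)
    (h : ∀ M₁ ⊆ E, M₁.card = s → ∀ B₁ ⊆ X, B₁.card ≤ q * s →
      CanWin X F q t (M ∪ M₁) (B ∪ B₁)) :
    CanWin X F q (t + s) M B := by
  induction s generalizing M B E with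
  | zero => simpa using h ∅ (by simp) (by simp) ∅ (by simp) (by simp)
  | succ s ih =>
    rw [← add_assoc]
    refine canWin_succ_of_forall_exists fun S hS _ hSq => ?_
    have h1 : E.card ≤ (E \ S).card + S.card := by
      have := Finset.le_card_sdiff S E
      omega
    have h2 : (E \ S).Nonempty := by
      rw [← Finset.card_pos]
      have : (q + 1) * (s + 1) = (q + 1) * s + q + 1 := by ring
      omega
    obtain ⟨e, he⟩ := h2
    have heE : e ∈ E := (Finset.mem_sdiff.1 he).1
    have heS : e ∉ S := (Finset.mem_sdiff.1 he).2
    refine ⟨e, ?_, ?_⟩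
    · have := Finset.disjoint_left.1 hEB heE
      simp [hEX heE, heS, this]
    · refine ih (E := (E \ S).erase e) ?_ ?_ ?_ ?_
      · exact (Finset.erase_subset _ _).trans (Finset.sdiff_subset.trans hEX)
      · rw [Finset.disjoint_left] at hEB ⊢
        intro x hx
        simp only [Finset.mem_erase, Finset.mem_sdiff] at hx
        simp [hEB hx.2.1, hx.2.2]
      · rw [Finset.card_erase_of_mem he]
        have : (q + 1) * (s + 1) = (q + 1) * s + q + 1 := by ring
        omega
      · intro M₁ hM₁ hM₁s B₁ hB₁ hB₁s
        have heM : e ∉ M₁ := fun hx => by simpa using hM₁ hx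
        have := h (insert e M₁) ?_ ?_ (S ∪ B₁) (Finset.union_subset hS hB₁) ?_
        · rwa [← Finset.union_assoc, Finset.union_insert, ← Finset.insert_union] at this
        · intro x hx
          rcases Finset.mem_insert.1 hx with rfl | hx
          · exact heE
          · have := hM₁ hx
            simp only [Finset.mem_erase, Finset.mem_sdiff] at this
            exact this.2.1
        · rw [Finset.card_insert_of_notMem heM, hM₁s]
        · have h3 := Finset.card_union_le S B₁
          have : q * (s + 1) = q * s + q := by ring
          omega

/-- A winning round of the relaxed game yields a legal move in the game itself, where Maker owns
`M' ⊇ M`: if the reply in the relaxed game is already owned, any legal move will do. -/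
lemma CanWin.exists_isMove {t : ℕ} {M M' B S : Finset α} (h : CanWin X F q (t + 1) M B)
    (hM : M ⊆ M') (hS : IsMove (X \ (M' ∪ B)) q S) :
    ∃ R, IsMove (X \ (M' ∪ (B ∪ S))) 1 R ∧ ∃ M₁ ⊆ M' ∪ R, CanWin X F q t M₁ (B ∪ S) := by
  have hSM : Disjoint S M := by
    rw [Finset.disjoint_left]
    intro x hx hxM
    have := hS.1 hx
    simp [hM hxM] at this
  obtain ⟨T, hTX, hTB, hT1, hw⟩ := h S (hS.1.trans Finset.sdiff_subset) hSM
    (hS.2.trans_le (min_le_left _ _))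
  by_cases hT : T ⊆ M'
  · obtain ⟨R, hR⟩ := MakerBreaker.exists_isMove (X \ (M' ∪ (B ∪ S))) 1
    exact ⟨R, hR, M ∪ T, (Finset.union_subset hM hT).trans Finset.subset_union_left, hw⟩
  · obtain ⟨x, hxT, hxM⟩ := Finset.not_subset.1 hT
    have hTx : T = {x} := by
      refine Finset.eq_singleton_iff_unique_mem.2 ⟨hxT, fun y hy => ?_⟩
      exact Finset.card_le_one.1 hT1 y hy x hxT
    have hxF : x ∈ X \ (M' ∪ (B ∪ S)) := by
      rw [Finset.mem_sdiff, Finset.mem_union, not_or]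
      exact ⟨hTX hxT, hxM, Finset.disjoint_left.1 hTB hxT⟩
    refine ⟨T, ⟨by simpa [hTx] using hxF, ?_⟩, M ∪ T, Finset.union_subset_union_left hM, hw⟩
    have : 0 < (X \ (M' ∪ (B ∪ S))).card := Finset.card_pos.2 ⟨x, hxF⟩
    rw [hTx, Finset.card_singleton]
    omega

open Classical in
/-- A legal move of Maker which keeps, if possible, the position winning within `t` rounds. -/
noncomputable def reply (X : Finset α) (F : Set (Finset α)) (q t : ℕ) (M B S : Finset α) :
    Finset α :=
  if h : ∃ R, IsMove (X \ (M ∪ (B ∪ S))) 1 R ∧ ∃ M₁ ⊆ M ∪ R, CanWin X F q t M₁ (B ∪ S)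
  then h.choose else (exists_isMove (X \ (M ∪ (B ∪ S))) 1).choose

/-- What Maker owns after answering each of Breaker's moves by `reply`, in a game of `t` rounds. -/
noncomputable def claimed (X : Finset α) (F : Set (Finset α)) (q t : ℕ) :
    List (Finset α) → Finset α
  | [] => ∅
  | S :: h => claimed X F q t h ∪
      reply X F q (t - (h.length + 1)) (claimed X F q t h) (breakerSet h) S

/-- The strategy that always plays `reply`, in a game of `t` rounds. -/
noncomputable def winStrategy (X : Finset α) (F : Set (Finset α)) (q t : ℕ) :
    List (Finset α) → Finset α
  | [] => ∅
  | S :: h => reply X F q (t - (h.length + 1)) (claimed X F q t h) (breakerSet h) S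

lemma makerSet_winStrategy (t : ℕ) (h : List (Finset α)) :
    makerSet (winStrategy X F q t) h = claimed X F q t h := by
  induction h with
  | nil => rfl
  | cons S h ih => simp only [makerSet, claimed, ih, winStrategy]

lemma isMove_reply (t : ℕ) (M B S : Finset α) :
    IsMove (X \ (M ∪ (B ∪ S))) 1 (reply X F q t M B S) := by
  unfold reply
  split_ifs with h
  · exact h.choose_spec.1
  · exact (exists_isMove (X \ (M ∪ (B ∪ S))) 1).choose_spec

theorem makerWinsWithin_of_canWin {t : ℕ} (h : CanWin X F q t ∅ ∅) :
    MakerWinsWithin X F 1 q t := by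
  refine ⟨winStrategy X F q t, ?_, ?_⟩
  · intro S h _
    rw [makerSet_winStrategy]
    exact isMove_reply _ _ _ _
  · have key : ∀ l : List (Finset α), BreakerPlay X q (winStrategy X F q t) l → l.length ≤ t →
        ∃ M ⊆ claimed X F q t l, CanWin X F q (t - l.length) M (breakerSet l) := by
      intro l
      induction l with
      | nil => exact fun _ _ => ⟨∅, by simp, by simpa [breakerSet] using h⟩
      | cons S l ih =>
        intro hp hl
        rw [List.length_cons] at hl
        obtain ⟨hp, hS⟩ := hp
        obtain ⟨M, hM, hw⟩ := ih hp (by omega)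
        rw [makerSet_winStrategy] at hS
        have e : t - l.length = (t - (l.length + 1)) + 1 := by omega
        rw [e] at hw
        have hex := hw.exists_isMove hM hS
        have := hex.choose_spec.2
        simp only [List.length_cons, breakerSet, claimed, reply]
        rw [dif_pos hex]
        exact this
    intro l hp hl
    obtain ⟨M, hM, hw⟩ := key l hp hl.le
    rw [hl, Nat.sub_self] at hw
    obtain ⟨W, hW, hWM⟩ := hw
    exact ⟨W, hW, by rw [makerSet_winStrategy]; exact hWM.trans hM⟩

end Game

/-! ### Vertex sequences and their exchanges -/

section Tours

variable {V : Type*}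

/-- The pairs of consecutive entries of a list. -/
def pairs : List V → Multiset (Sym2 V)
  | x :: y :: l => s(x, y) ::ₘ pairs (y :: l)
  | _ => 0

lemma pairs_append {A B : List V} {v w : V} (hA : A.getLast? = some v) (hB : B.head? = some w) :
    pairs (A ++ B) = pairs A + pairs B + {s(v, w)} := by
  induction A with
  | nil => simp at hA
  | cons x A ih =>
    cases A with
    | nil =>
      cases B with
      | nil => simp at hB
      | cons y B =>
        simp only [List.getLast?_singleton, Option.some.injEq, List.head?_cons] at hA hB
        subst hA hB
        simp [pairs, ← Multiset.singleton_add, add_comm]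
    | cons z A =>
      have := ih (by simpa using hA)
      simp only [List.cons_append, pairs, Multiset.cons_add] at this ⊢
      rw [this]

lemma pairs_reverse (L : List V) : pairs L.reverse = pairs L := by
  induction L with
  | nil => rfl
  | cons x L ih =>
    cases L with
    | nil => rfl
    | cons y L =>
      rw [List.reverse_cons, pairs_append (v := y) (w := x) (by simp) (by simp), ih]
      simp [pairs, ← Multiset.singleton_add, add_comm, Sym2.eq_swap]

lemma exists_of_mem_pairs {L : List V} {e : Sym2 V} (he : e ∈ pairs L) :
    ∃ i x y, L[i]? = some x ∧ L[i + 1]? = some y ∧ e = s(x, y) := by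
  induction L with
  | nil => simp [pairs] at he
  | cons x L ih =>
    cases L with
    | nil => simp [pairs] at he
    | cons y L =>
      rw [pairs, Multiset.mem_cons] at he
      rcases he with rfl | he
      · exact ⟨0, x, y, by simp, by simp, rfl⟩
      · obtain ⟨i, x', y', h1, h2, h3⟩ := ih he
        exact ⟨i + 1, x', y', by simpa using h1, by simpa using h2, h3⟩

lemma card_pairs (L : List V) : (pairs L).card = L.length - 1 := by
  induction L with
  | nil => rfl
  | cons x L ih =>
    cases L with
    | nil => rfl
    | cons y L => simp [pairs, ih]

lemma exists_append_of_getElem? {L : List V} {i : ℕ} {v w : V} (hv : L[i]? = some v)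
    (hw : L[i + 1]? = some w) :
    ∃ A B, L = A ++ B ∧ A.length = i + 1 ∧ A.getLast? = some v ∧ B.head? = some w := by
  have hi : i + 1 < L.length := (List.getElem?_eq_some_iff.1 hw).1
  refine ⟨L.take (i + 1), L.drop (i + 1), by simp, by simp; omega, ?_, ?_⟩
  · rw [List.getLast?_take]
    simp [hv]
  · simpa [List.head?_drop] using hw

lemma eq_of_getElem?_eq_some {L : List V} (hL : L.Nodup) {i j : ℕ} {v : V} (hi : L[i]? = some v)
    (hj : L[j]? = some v) : i = j :=
  (hL.getElem_inj_iff (hi := (List.getElem?_eq_some_iff.1 hi).1)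
    (hj := (List.getElem?_eq_some_iff.1 hj).1)).1 <|
    (List.getElem?_eq_some_iff.1 hi).2.trans (List.getElem?_eq_some_iff.1 hj).2.symm

/-- `L` lists every vertex once and its two ends are `a` and `b`. Either end may come first, so that
tours can be reversed. -/
structure IsTour (a b : V) (L : List V) : Prop where
  nodup : L.Nodup
  mem : ∀ v, v ∈ L
  ends : (L.head? = some a ∧ L.getLast? = some b) ∨ (L.head? = some b ∧ L.getLast? = some a)

variable {a b : V} {L : List V}

lemma IsTour.reverse (h : IsTour a b L) : IsTour a b L.reverse where
  nodup := List.nodup_reverse.2 h.nodup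
  mem v := List.mem_reverse.2 (h.mem v)
  ends := by
    rw [List.head?_reverse, List.getLast?_reverse]
    have := h.ends
    tauto

lemma IsTour.of_perm {L' : List V} (h : IsTour a b L) (hp : L'.Perm L)
    (h1 : L'.head? = L.head?) (h2 : L'.getLast? = L.getLast?) : IsTour a b L' where
  nodup := hp.nodup_iff.2 h.nodup
  mem v := hp.mem_iff.2 (h.mem v)
  ends := by rw [h1, h2]; exact h.ends

/-- Reversing the segment from `w₁` to `v₂` replaces the pairs `v₁w₁` and `v₂w₂` by `v₁v₂` and
`w₁w₂`. -/
lemma IsTour.two_opt (h : IsTour a b L) {i j : ℕ} (hij : i ≠ j) {v₁ w₁ v₂ w₂ : V}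
    (hv₁ : L[i]? = some v₁) (hw₁ : L[i + 1]? = some w₁) (hv₂ : L[j]? = some v₂)
    (hw₂ : L[j + 1]? = some w₂) :
    ∃ L' P, IsTour a b L' ∧ pairs L = P + {s(v₁, w₁), s(v₂, w₂)} ∧
      pairs L' = P + {s(v₁, v₂), s(w₁, w₂)} := by
  wlog hlt : i < j generalizing i j v₁ w₁ v₂ w₂
  · obtain ⟨L', P, h1, h2, h3⟩ := this hij.symm hv₂ hw₂ hv₁ hw₁ (by omega)
    refine ⟨L', P, h1, by rw [h2, Multiset.pair_comm], ?_⟩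
    rw [h3, Sym2.eq_swap, Sym2.eq_swap (a := w₂)]
  obtain ⟨A, R, rfl, hA, hAv, hRw⟩ := exists_append_of_getElem? hv₁ hw₁
  obtain ⟨j, rfl⟩ : ∃ j', j = i + 1 + j' := ⟨j - (i + 1), by omega⟩
  rw [List.getElem?_append_right (by omega)] at hv₂ hw₂
  obtain ⟨C, D, rfl, hC, hCv, hDw⟩ := exists_append_of_getElem? hv₂
    (by rw [← hw₂]; congr 1; omega)
  have hCne : C ≠ [] := by rintro rfl; simp at hCv
  have hCw : C.head? = some w₁ := by
    rwa [List.head?_append_of_ne_nil _ hCne] at hRw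
  have hDl : ∃ z, D.getLast? = some z := by
    cases D with
    | nil => simp at hDw
    | cons x D => exact ⟨_, List.getLast?_eq_some_getLast (by simp)⟩
  have hAh : ∃ z, A.head? = some z := by
    cases A with
    | nil => simp at hAv
    | cons x D => exact ⟨x, rfl⟩
  obtain ⟨z, hz⟩ := hDl
  obtain ⟨z', hz'⟩ := hAh
  refine ⟨A ++ (C.reverse ++ D), pairs A + pairs C + pairs D, ?_, ?_, ?_⟩
  · refine h.of_perm ?_ ?_ ?_
    · exact List.Perm.append_left _ (List.Perm.append_right _ (List.reverse_perm C))
    · simp [List.head?_append, hz']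
    · simp [List.getLast?_append, hz]
  · rw [pairs_append (v := v₁) (w := w₁) hAv hRw, pairs_append (v := v₂) (w := w₂) hCv hDw]
    simp only [Multiset.insert_eq_cons, ← Multiset.singleton_add]
    abel
  · rw [pairs_append (v := v₁) (w := v₂) hAv
      (by simp [List.head?_append, hCv]), pairs_append (v := w₁) (w := w₂)
      (by simp [hCw]) hDw, pairs_reverse]
    simp only [Multiset.insert_eq_cons, ← Multiset.singleton_add]
    abel

/-- Reversing each of the adjacent segments from `w` to `x` and from `y` to `p` replaces the pairs
`vw`, `xy` and `pp'` by `vx`, `wp` and `yp'`. -/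
lemma IsTour.three_opt (h : IsTour a b L) {g i j : ℕ} (hgi : g < i) (hij : i < j)
    {v w x y p p' : V} (hv : L[g]? = some v) (hw : L[g + 1]? = some w) (hx : L[i]? = some x)
    (hy : L[i + 1]? = some y) (hp : L[j]? = some p) (hp' : L[j + 1]? = some p') :
    ∃ L' P, IsTour a b L' ∧ pairs L = P + {s(v, w), s(x, y), s(p, p')} ∧
      pairs L' = P + {s(v, x), s(w, p), s(y, p')} := by
  obtain ⟨A, R, rfl, hA, hAv, hRw⟩ := exists_append_of_getElem? hv hw
  obtain ⟨i, rfl⟩ : ∃ i', i = g + 1 + i' := ⟨i - (g + 1), by omega⟩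
  obtain ⟨j, rfl⟩ : ∃ j', j = g + 1 + (i + 1 + j') := ⟨j - (g + 1 + (i + 1)), by omega⟩
  rw [List.getElem?_append_right (by omega)] at hx hy hp hp'
  obtain ⟨C, R', rfl, hC, hCv, hDw⟩ := exists_append_of_getElem? hx
    (by rw [← hy]; congr 1; omega)
  rw [List.getElem?_append_right (by omega)] at hp hp'
  obtain ⟨D, E, rfl, hD, hDv, hEw⟩ := exists_append_of_getElem? hp
    (by rw [← hp']; congr 1; omega)
  have hCne : C ≠ [] := by rintro rfl; simp at hCv
  have hDne : D ≠ [] := by rintro rfl; simp at hDv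
  have hCw : C.head? = some w := by
    rwa [List.head?_append_of_ne_nil _ hCne] at hRw
  have hDh : D.head? = some y := by
    rwa [List.head?_append_of_ne_nil _ hDne] at hDw
  have hDl : ∃ z, E.getLast? = some z := by
    cases E with
    | nil => simp at hEw
    | cons x D => exact ⟨_, List.getLast?_eq_some_getLast (by simp)⟩
  have hAh : ∃ z, A.head? = some z := by
    cases A with
    | nil => simp at hAv
    | cons x D => exact ⟨x, rfl⟩
  obtain ⟨z, hz⟩ := hDl
  obtain ⟨z', hz'⟩ := hAh
  refine ⟨A ++ (C.reverse ++ (D.reverse ++ E)), pairs A + pairs C + pairs D + pairs E, ?_, ?_, ?_⟩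
  · refine h.of_perm ?_ ?_ ?_
    · exact List.Perm.append_left _ (List.Perm.append (List.reverse_perm C)
        (List.Perm.append_right _ (List.reverse_perm D)))
    · simp [List.head?_append, hz']
    · simp [List.getLast?_append, hz]
  · rw [pairs_append (v := v) (w := w) hAv hRw, pairs_append (v := x) (w := y) hCv hDw,
      pairs_append hDv hEw]
    simp only [Multiset.insert_eq_cons, ← Multiset.singleton_add]
    abel
  · rw [pairs_append (v := v) (w := x) hAv
      (by simp [List.head?_append, hCv]), pairs_append (v := w) (w := p)
      (by simp [hCw]) (by simp [List.head?_append, hDv]),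
      pairs_append (v := y) (w := p') (by simp [hDh]) hEw, pairs_reverse, pairs_reverse]
    simp only [Multiset.insert_eq_cons, ← Multiset.singleton_add]
    abel

lemma exists_walk (G : SimpleGraph V) (x : V) (L : List V)
    (h : ∀ e ∈ pairs (x :: L), e ∈ G.edgeSet) {y : V} (hy : (x :: L).getLast? = some y) :
    ∃ P : G.Walk x y, P.support = x :: L ∧ ∀ e ∈ P.edges, e ∈ pairs (x :: L) := by
  induction L generalizing x with
  | nil =>
    simp only [List.getLast?_singleton, Option.some.injEq] at hy
    subst hy
    exact ⟨.nil, rfl, by simp⟩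
  | cons z L ih =>
    rw [pairs] at h
    obtain ⟨P, hP, hPe⟩ := ih z (fun e he => h e (Multiset.mem_cons_of_mem he)) (by simpa using hy)
    have hxz : G.Adj x z := h s(x, z) (Multiset.mem_cons_self _ _)
    refine ⟨.cons hxz P, by simp [hP], ?_⟩
    intro e he
    rw [SimpleGraph.Walk.edges_cons, List.mem_cons] at he
    rw [pairs, Multiset.mem_cons]
    exact he.imp id (hPe e)

variable [DecidableEq V]

/-- The consecutive pairs of `L` that do not belong to `M`. -/
def gaps (L : List V) (M : Finset (Sym2 V)) : Multiset (Sym2 V) :=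
  (pairs L).filter (· ∉ M)

lemma mem_gaps {M : Finset (Sym2 V)} {e : Sym2 V} : e ∈ gaps L M ↔ e ∈ pairs L ∧ e ∉ M :=
  Multiset.mem_filter

lemma card_filter_notMem_anti {P : Multiset (Sym2 V)} {M M' : Finset (Sym2 V)} (h : M ⊆ M') :
    (P.filter (· ∉ M')).card ≤ (P.filter (· ∉ M)).card :=
  Multiset.card_le_card <| Multiset.monotone_filter_right P
    (show ∀ e, e ∉ M' → e ∉ M from fun _ h₁ h₂ => h₁ (h h₂))

/-- The entries of a list that are followed by a gap. -/
def leftEnds (M : Finset (Sym2 V)) : List V → List V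
  | x :: y :: l => if s(x, y) ∈ M then leftEnds M (y :: l) else x :: leftEnds M (y :: l)
  | _ => []

lemma length_leftEnds (M : Finset (Sym2 V)) (L : List V) :
    (leftEnds M L).length = (gaps L M).card := by
  induction L with
  | nil => rfl
  | cons x L ih =>
    cases L with
    | nil => rfl
    | cons y L =>
      rw [gaps] at ih ⊢
      rw [leftEnds, pairs]
      split_ifs with h
      · rw [ih, Multiset.filter_cons_of_neg (p := (· ∉ M)) _ (not_not.2 h)]
      · rw [List.length_cons, ih, Multiset.filter_cons_of_pos (p := (· ∉ M)) _ h,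
          Multiset.card_cons]

lemma leftEnds_sublist (M : Finset (Sym2 V)) (L : List V) : (leftEnds M L).Sublist L := by
  induction L with
  | nil => simp [leftEnds]
  | cons x L ih =>
    cases L with
    | nil => simp [leftEnds]
    | cons y L =>
      rw [leftEnds]
      split_ifs with h
      · exact ih.cons x
      · exact ih.cons_cons x

lemma exists_of_mem_leftEnds {M : Finset (Sym2 V)} {v : V} (hv : v ∈ leftEnds M L) :
    ∃ i w, L[i]? = some v ∧ L[i + 1]? = some w ∧ s(v, w) ∉ M := by
  induction L with
  | nil => simp [leftEnds] at hv
  | cons x L ih =>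
    cases L with
    | nil => simp [leftEnds] at hv
    | cons y L =>
      have key : v ∈ leftEnds M (y :: L) → ∃ i w, (x :: y :: L)[i]? = some v ∧
          (x :: y :: L)[i + 1]? = some w ∧ s(v, w) ∉ M := by
        intro hv
        obtain ⟨i, w, h1, h2, h3⟩ := ih hv
        exact ⟨i + 1, w, by simpa using h1, by simpa using h2, h3⟩
      rw [leftEnds] at hv
      split_ifs at hv with h
      · exact key hv
      · rcases List.mem_cons.1 hv with rfl | hv
        · exact ⟨0, y, by simp, by simp, h⟩
        · exact key hv

/-- After reversing the tour if necessary, a given endpoint `v` of a gap comes first in the gap. -/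
lemma IsTour.exists_gap_right {M : Finset (Sym2 V)} (h : IsTour a b L) {v : V} {e : Sym2 V}
    (he : e ∈ gaps L M) (hv : v ∈ e) :
    ∃ L' i w, IsTour a b L' ∧ pairs L' = pairs L ∧ L'[i]? = some v ∧ L'[i + 1]? = some w ∧
      s(v, w) ∉ M := by
  obtain ⟨he, heM⟩ := mem_gaps.1 he
  obtain ⟨i, x, y, hx, hy, rfl⟩ := exists_of_mem_pairs he
  rcases Sym2.mem_iff.1 hv with rfl | rfl
  · exact ⟨L, i, y, h, rfl, hx, hy, heM⟩
  · have hlt : i + 1 < L.length := (List.getElem?_eq_some_iff.1 hy).1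
    refine ⟨L.reverse, L.length - 1 - (i + 1), x, h.reverse, pairs_reverse L, ?_, ?_, ?_⟩
    · rw [List.getElem?_reverse (by omega), ← hy]
      congr 1
      omega
    · rw [List.getElem?_reverse (by omega), ← hx]
      congr 1
      omega
    · rwa [Sym2.eq_swap]

/-- A set of consecutive pairs of a list without repetitions has degree at most 2. -/
lemma card_filter_mem_le_two (hL : L.Nodup) {M : Finset (Sym2 V)} (hM : ∀ e ∈ M, e ∈ pairs L)
    (v : V) : (M.filter (v ∈ ·)).card ≤ 2 := by
  by_cases hv : v ∈ L
  · obtain ⟨i, hi⟩ := List.mem_iff_getElem?.1 hv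
    refine (Finset.card_le_card (t := {s(v, L.getD (i + 1) v), s(L.getD (i - 1) v, v)}) ?_).trans
      Finset.card_le_two
    intro e he
    obtain ⟨heM, hve⟩ := Finset.mem_filter.1 he
    obtain ⟨l, x, y, hx, hy, rfl⟩ := exists_of_mem_pairs (hM e heM)
    rcases Sym2.mem_iff.1 hve with rfl | rfl
    · obtain rfl := eq_of_getElem?_eq_some hL hi hx
      simp [hy]
    · obtain rfl := eq_of_getElem?_eq_some hL hi hy
      simp [hx]
  · rw [Finset.card_eq_zero.2]
    · omega
    · refine Finset.filter_eq_empty_iff.2 fun e he hve => hv ?_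
      obtain ⟨l, x, y, hx, hy, rfl⟩ := exists_of_mem_pairs (hM e he)
      rcases Sym2.mem_iff.1 hve with rfl | rfl
      · exact List.mem_of_getElem? hx
      · exact List.mem_of_getElem? hy

lemma IsTour.exists_hamPathSet (G : SimpleGraph V) (h : IsTour a b L)
    {M : Finset (Sym2 V)} (hM : ∀ e ∈ M, e ∈ G.edgeSet) (hg : gaps L M = 0) :
    ∃ W ∈ hamPathSets G a b, W ⊆ M := by
  have hpM : ∀ e ∈ pairs L, e ∈ M := by
    intro e he
    by_contra heM
    have : e ∈ gaps L M := mem_gaps.2 ⟨he, heM⟩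
    simp [hg] at this
  have key : ∀ a b, L.head? = some a → L.getLast? = some b →
      ∃ P : G.Walk a b, P.IsHamiltonian ∧ P.edges.toFinset ⊆ M := by
    intro a b ha hb
    cases L with
    | nil => simp at ha
    | cons x L =>
      simp only [List.head?_cons, Option.some.injEq] at ha
      subst ha
      obtain ⟨P, hP, hPe⟩ := exists_walk G x L (fun e he => hM e (hpM e he)) hb
      refine ⟨P, fun v => ?_, fun e he => hpM e (hPe e (List.mem_toFinset.1 he))⟩
      rw [hP]
      exact List.count_eq_one_of_mem h.nodup (h.mem v)
  rcases h.ends with ⟨h1, h2⟩ | ⟨h1, h2⟩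
  · obtain ⟨P, hP, hPM⟩ := key a b h1 h2
    exact ⟨_, ⟨P, hP, rfl⟩, hPM⟩
  · obtain ⟨P, hP, hPM⟩ := key b a h1 h2
    refine ⟨_, ⟨P.reverse, fun v => ?_, rfl⟩, by simpa using hPM⟩
    rw [SimpleGraph.Walk.support_reverse, List.count_reverse]
    exact hP v

lemma exists_isTour [Fintype V] (hab : a ≠ b) : ∃ L, IsTour a b L := by
  refine ⟨a :: ((Finset.univ.erase a).erase b).toList ++ [b], ?_, ?_, ?_⟩
  · simp only [List.cons_append, List.nodup_cons, List.mem_append, Finset.mem_toList,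
      Finset.mem_erase, List.mem_singleton, hab, List.nodup_append, Finset.nodup_toList]
    simp +contextual
  · intro v
    by_cases h1 : v = a <;> by_cases h2 : v = b <;> simp [h1, h2]
  · exact .inl ⟨rfl, List.getLast?_concat⟩

lemma IsTour.length_eq [Fintype V] (h : IsTour a b L) : L.length = Fintype.card V := by
  rw [← List.toFinset_card_of_nodup h.nodup, ← Finset.card_univ]
  congr 1
  ext v
  simp [h.mem v]

end Tours

/-! ### Degrees in sets of edges -/

section Degrees

variable {V : Type*} [DecidableEq V]

/-- The degree of `v` in the graph with edge set `B`. -/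
def edgeDegree (B : Finset (Sym2 V)) (v : V) : ℕ :=
  (B.filter (v ∈ ·)).card

lemma edgeDegree_mono {B B' : Finset (Sym2 V)} (h : B ⊆ B') (v : V) :
    edgeDegree B v ≤ edgeDegree B' v :=
  Finset.card_le_card (Finset.filter_subset_filter _ h)

lemma edgeDegree_union_le (B S : Finset (Sym2 V)) (v : V) :
    edgeDegree (B ∪ S) v ≤ edgeDegree B v + S.card := by
  unfold edgeDegree
  rw [Finset.filter_union]
  exact (Finset.card_union_le _ _).trans
    (Nat.add_le_add_left (Finset.card_filter_le _ _) _)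

variable [Fintype V]

lemma sum_edgeDegree_le (B : Finset (Sym2 V)) : ∑ v, edgeDegree B v ≤ 2 * B.card := by
  have h := Finset.sum_card_bipartiteAbove_eq_sum_card_bipartiteBelow
    (s := (Finset.univ : Finset V)) (t := B) (fun v e => v ∈ e)
  simp only [Finset.bipartiteAbove, Finset.bipartiteBelow] at h
  unfold edgeDegree
  rw [h, mul_comm]
  refine Finset.sum_le_card_nsmul _ _ _ fun e _ => ?_
  have : (Finset.univ.filter (· ∈ e)) = e.toFinset := by
    ext v
    simp [Sym2.mem_toFinset]
  rw [this, Sym2.card_toFinset]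
  split_ifs <;> omega

lemma mul_card_heavy_le (B : Finset (Sym2 V)) (d : ℕ) :
    d * (Finset.univ.filter (d ≤ edgeDegree B ·)).card ≤ 2 * B.card := by
  refine le_trans ?_ (sum_edgeDegree_le B)
  rw [mul_comm, ← smul_eq_mul]
  refine (Finset.card_nsmul_le_sum _ (edgeDegree B) d
    fun v hv => (Finset.mem_filter.1 hv).2).trans ?_
  exact Finset.sum_le_sum_of_subset (Finset.filter_subset _ _)

variable {G : SimpleGraph V} [DecidableRel G.Adj] {r : ℕ}

/-- Apart from the `r` vertices that are not adjacent to `v` in `G` (one of which is `v`), only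
edges in `B` prevent `v` from being joined to a vertex by an edge in `G \ B`. -/
lemma card_blocked_le (hr : ∀ v, Fintype.card V ≤ G.degree v + r) (B : Finset (Sym2 V)) (v : V) :
    (Finset.univ.filter (fun u => s(v, u) ∉ G.edgeFinset \ B)).card ≤ r + edgeDegree B v := by
  have h1 : (Finset.univ.filter (fun u => s(v, u) ∉ G.edgeFinset \ B)) ⊆
      (G.neighborFinset v)ᶜ ∪ Finset.univ.filter (fun u => s(v, u) ∈ B) := by
    intro u hu
    simp only [Finset.mem_filter, Finset.mem_univ, true_and, Finset.mem_sdiff,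
      SimpleGraph.mem_edgeFinset, SimpleGraph.mem_edgeSet, not_and, not_not] at hu
    simp only [Finset.mem_union, Finset.mem_compl, SimpleGraph.mem_neighborFinset,
      Finset.mem_filter, Finset.mem_univ, true_and]
    tauto
  refine (Finset.card_le_card h1).trans ((Finset.card_union_le _ _).trans (add_le_add ?_ ?_))
  · rw [Finset.card_compl, SimpleGraph.card_neighborFinset_eq_degree]
    have := hr v
    omega
  · refine Finset.card_le_card_of_injOn (fun u => s(v, u)) ?_ ?_
    · intro u hu
      simp only [Finset.coe_filter, Finset.mem_univ, true_and, Set.mem_ofPred_eq] at hu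
      simp [hu]
    · intro u _ u' _ h
      exact Sym2.congr_right.1 h

lemma card_filter_blocked_le (hr : ∀ v, Fintype.card V ≤ G.degree v + r) (B : Finset (Sym2 V))
    (v : V) {ι : Type*} {I : Finset ι} {f : ι → V} (hf : Set.InjOn f I) :
    (I.filter (fun i => s(v, f i) ∉ G.edgeFinset \ B)).card ≤ r + edgeDegree B v := by
  refine le_trans ?_ (card_blocked_le hr B v)
  refine Finset.card_le_card_of_injOn f ?_
    (hf.mono fun i hi => (Finset.mem_filter.1 (Finset.mem_coe.1 hi)).1)
  intro i hi
  simp only [Finset.coe_filter, Set.mem_ofPred_eq, Finset.mem_univ, true_and] at hi ⊢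
  exact hi.2

end Degrees

/-! ### Closing one gap -/

section CloseGap

variable {V : Type*} [DecidableEq V] {a b : V} {L L' : List V}

lemma card_gaps_lt {P : Multiset (Sym2 V)} {M M' : Finset (Sym2 V)} {e₁ e₂ e₃ f₁ f₂ f₃ : Sym2 V}
    (hL : pairs L = P + {e₁, e₂, e₃}) (hL' : pairs L' = P + {f₁, f₂, f₃}) (hM : M ⊆ M')
    (he : e₁ ∉ M) (h₁ : f₁ ∈ M') (h₂ : f₂ ∈ M') (h₃ : f₃ ∈ M') :
    (gaps L' M').card < (gaps L M).card := by
  have h := card_filter_notMem_anti (P := P) hM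
  have e1 : gaps L' M' = P.filter (· ∉ M') := by
    rw [gaps, hL', Multiset.filter_add]
    simp [Multiset.filter_cons_of_neg, Multiset.filter_singleton, h₁, h₂, h₃]
  have e2 : (P.filter (· ∉ M)).card + 1 ≤ (gaps L M).card := by
    rw [gaps, hL, Multiset.filter_add, Multiset.card_add]
    simp [Multiset.filter_cons_of_pos, he]
  rw [e1]
  omega

lemma mem_gaps_of_mem_gaps {P : Multiset (Sym2 V)} {M M' : Finset (Sym2 V)}
    {e₁ e₂ e₃ f₁ f₂ f₃ : Sym2 V}
    (hL : pairs L = P + {e₁, e₂, e₃}) (hL' : pairs L' = P + {f₁, f₂, f₃}) (hM : M ⊆ M')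
    (h₁ : f₁ ∈ M') (h₂ : f₂ ∈ M') (h₃ : f₃ ∈ M') {e : Sym2 V} (he : e ∈ gaps L' M') :
    e ∈ gaps L M := by
  rw [mem_gaps] at he ⊢
  obtain ⟨h, heM⟩ := he
  refine ⟨?_, fun h => heM (hM h)⟩
  rw [hL', Multiset.mem_add] at h
  rcases h with h | h
  · rw [hL]
    exact Multiset.mem_add.2 (.inl h)
  · simp only [Multiset.insert_eq_cons, Multiset.mem_cons, Multiset.mem_singleton] at h
    rcases h with rfl | rfl | rfl <;> contradiction

/-- After reversing the tour if necessary, a given gap lies in its first half. -/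
lemma IsTour.exists_gap_first_half {M : Finset (Sym2 V)} (h : IsTour a b L) {e : Sym2 V}
    (he : e ∈ gaps L M) :
    ∃ L' i v w, IsTour a b L' ∧ pairs L' = pairs L ∧ L'[i]? = some v ∧ L'[i + 1]? = some w ∧
      2 * i + 2 ≤ L'.length ∧ e = s(v, w) := by
  obtain ⟨he, heM⟩ := mem_gaps.1 he
  obtain ⟨i, x, y, hx, hy, rfl⟩ := exists_of_mem_pairs he
  have hlt : i + 1 < L.length := (List.getElem?_eq_some_iff.1 hy).1
  by_cases hi : 2 * i + 2 ≤ L.length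
  · exact ⟨L, i, x, y, h, rfl, hx, hy, hi, rfl⟩
  · refine ⟨L.reverse, L.length - 1 - (i + 1), y, x, h.reverse, pairs_reverse L, ?_, ?_, ?_,
      Sym2.eq_swap⟩
    · rw [List.getElem?_reverse (by omega), ← hy]
      congr 1
      omega
    · rw [List.getElem?_reverse (by omega), ← hx]
      congr 1
      omega
    · rw [List.length_reverse]
      omega

variable [Fintype V] {G : SimpleGraph V} [DecidableRel G.Adj] {r : ℕ}

/-- Maker can close a gap `e` of a tour within `q + 3` rounds, without creating new gaps, provided
that Breaker's degree at the two ends of `e` is small. The edges that Maker claims lead to two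
consecutive blocks of `h` vertices each, the first of which starts at the second end of `e`. -/
theorem canWin_of_close_gap (hr : ∀ v, Fintype.card V ≤ G.degree v + r) {q D h t : ℕ}
    (hh : 4 * h + 2 ≤ Fintype.card V)
    (hh₁ : 16 * ((q + 1) * (q + 1) + r + D) + Fintype.card V ≤ 16 * h)
    (hh₂ : (q + 2) * r + D + (q + 1) * (64 * (q + 1) + q * (q + 2)) < h)
    (hL : IsTour a b L) {M B : Finset (Sym2 V)} (hM : M ⊆ G.edgeFinset)
    {e : Sym2 V} (he : e ∈ gaps L M) (hD : ∀ z ∈ e, edgeDegree B z + q * (q + 3) ≤ D)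
    (hB : B.card ≤ 2 * (q * Fintype.card V))
    {F : Set (Finset (Sym2 V))}
    (hwin : ∀ L' M' B', IsTour a b L' → M' ⊆ G.edgeFinset →
      (gaps L' M').card < (gaps L M).card → (∀ e' ∈ gaps L' M', e' ∈ gaps L M) →
      B'.card ≤ B.card + q * (q + 3) →
      (∀ z, edgeDegree B' z ≤ edgeDegree B z + q * (q + 3)) →
      CanWin G.edgeFinset F q t M' B') :
    CanWin G.edgeFinset F q (t + (q + 3)) M B := by
  obtain ⟨L₁, g, v, w, hL₁, hp₁, hv, hw, hg, rfl⟩ := hL.exists_gap_first_half he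
  have hvw : s(v, w) ∉ M := (mem_gaps.1 he).2
  have hgaps : gaps L₁ M = gaps L M := by rw [gaps, gaps, hp₁]
  rw [← hgaps] at hwin
  have hlen := hL₁.length_eq
  set k := Fintype.card V with hk
  let f : ℕ → V := fun i => L₁.getD i v
  have hf : ∀ i, i < k → L₁[i]? = some (f i) := by
    intro i hi
    simp [f, List.getElem?_eq_getElem (hlen ▸ hi)]
  have hinj : ∀ i j, i < k → j < k → f i = f j → i = j := by
    intro i j hi hj hij
    exact eq_of_getElem?_eq_some hL₁.nodup (hf i hi) (by rw [hij]; exact hf j hj)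
  have hDv := hD v (by simp)
  have hDw := hD w (by simp)
  -- Only vertices with a successor of low Breaker degree are used, so that the `q + 1` successors
  -- together exclude few candidates for `p'`.
  let H₁ := Finset.Ico (g + 1) (g + 1 + h)
  let I₀ := H₁.filter (fun i => s(v, f i) ∈ G.edgeFinset \ B ∧
    edgeDegree B (f (i + 1)) < 64 * (q + 1))
  have hI₀k : ∀ i ∈ I₀, g < i ∧ i < g + 1 + h ∧ i + 1 < k := by
    intro i hi
    have := Finset.mem_Ico.1 (Finset.mem_filter.1 hi).1
    omega
  have hI₀ : (q + 1) * (q + 1) ≤ I₀.card := by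
    have h1 : (H₁.filter (fun i => s(v, f i) ∉ G.edgeFinset \ B)).card ≤ r + edgeDegree B v := by
      refine card_filter_blocked_le hr B v ?_
      intro i hi j hj hij
      simp only [H₁, Finset.coe_Ico, Set.mem_Ico] at hi hj
      exact hinj i j (by omega) (by omega) hij
    have h2 : (H₁.filter (fun i => 64 * (q + 1) ≤ edgeDegree B (f (i + 1)))).card ≤
        (Finset.univ.filter (64 * (q + 1) ≤ edgeDegree B ·)).card := by
      refine Finset.card_le_card_of_injOn (fun i => f (i + 1)) ?_ ?_
      · intro i hi
        simp only [Finset.coe_filter, Set.mem_ofPred_eq, Finset.mem_univ, true_and] at hi ⊢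
        exact hi.2
      · intro i hi j hj hij
        simp only [H₁, Finset.coe_filter, Finset.mem_Ico, Set.mem_ofPred_eq] at hi hj
        have := hinj (i + 1) (j + 1) (by omega) (by omega) hij
        omega
    have h3 := mul_card_heavy_le B (64 * (q + 1))
    have h4 : H₁ ⊆ I₀ ∪ (H₁.filter (fun i => s(v, f i) ∉ G.edgeFinset \ B) ∪
        H₁.filter (fun i => 64 * (q + 1) ≤ edgeDegree B (f (i + 1)))) := by
      intro i hi
      simp only [I₀, Finset.mem_union, Finset.mem_filter, hi, true_and]
      by_cases h1 : s(v, f i) ∈ G.edgeFinset \ B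
      · by_cases h2 : edgeDegree B (f (i + 1)) < 64 * (q + 1)
        · exact .inl ⟨h1, h2⟩
        · exact .inr (.inr (by omega))
      · exact .inr (.inl h1)
    have h5 := (Finset.card_le_card h4).trans ((Finset.card_union_le _ _).trans
      (Nat.add_le_add_left (Finset.card_union_le _ _) _))
    have h6 : H₁.card = h := by simp [H₁]
    have h7 : 16 * (Finset.univ.filter (64 * (q + 1) ≤ edgeDegree B ·)).card ≤ k := by
      refine Nat.le_of_mul_le_mul_left (?_ : (4 * (q + 1)) * _ ≤ (4 * (q + 1)) * _) (by omega)
      calc _ = 64 * (q + 1) * (Finset.univ.filter (64 * (q + 1) ≤ edgeDegree B ·)).card := by ring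
        _ ≤ 2 * (2 * (q * k)) := h3.trans (Nat.mul_le_mul_left 2 hB)
        _ ≤ _ := by nlinarith
    omega
  have hfI : Set.InjOn (fun i => s(v, f i)) I₀ := by
    intro i hi j hj hij
    have hi := hI₀k i hi
    have hj := hI₀k j hj
    exact hinj i j (by omega) (by omega) (Sym2.congr_right.1 hij)
  have hE : ∀ e ∈ I₀.image (fun i => s(v, f i)), e ∈ G.edgeFinset \ B := by
    intro e he
    obtain ⟨i, hi, rfl⟩ := Finset.mem_image.1 he
    exact (Finset.mem_filter.1 hi).2.1
  rw [show t + (q + 3) = (t + 1 + 1) + (q + 1) by ring]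
  refine canWin_collect (q + 1) (E := I₀.image (fun i => s(v, f i)))
    (fun e he => (Finset.mem_sdiff.1 (hE e he)).1)
    (Finset.disjoint_left.2 fun e he => (Finset.mem_sdiff.1 (hE e he)).2)
    (by rwa [Finset.card_image_of_injOn hfI]) ?_
  intro M₁ hM₁ hM₁c B₁ _ hB₁c
  have hM₁E : M₁ ⊆ G.edgeFinset := fun e he => (Finset.mem_sdiff.1 (hE e (hM₁ he))).1
  obtain ⟨I, hI, rfl⟩ := Finset.subset_image_iff.1 hM₁
  rw [Finset.card_image_of_injOn (hfI.mono hI)] at hM₁c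
  refine canWin_succ_of_forall_exists fun S₁ _ _ hS₁ => ?_
  set B₂ := B ∪ B₁ ∪ S₁ with hB₂
  have hB₂B : ∀ z, edgeDegree B₂ z ≤ edgeDegree B z + q * (q + 2) := by
    intro z
    have h1 := edgeDegree_union_le (B ∪ B₁) S₁ z
    have h2 := edgeDegree_union_le B B₁ z
    rw [← hB₂] at h1
    linarith
  -- One edge at `w` creates `q + 1` threats at once, one more than Breaker can answer.
  obtain ⟨j, hj, hwj, hjI⟩ : ∃ j ∈ Finset.Ico (g + 1 + h) (g + 1 + 2 * h),
      s(w, f j) ∈ G.edgeFinset \ B₂ ∧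
      ∀ i ∈ I, s(f (i + 1), f (j + 1)) ∈ G.edgeFinset \ B₂ := by
    by_contra! hcon
    have h1 : Finset.Ico (g + 1 + h) (g + 1 + 2 * h) ⊆
        (Finset.Ico (g + 1 + h) (g + 1 + 2 * h)).filter
          (fun j => s(w, f j) ∉ G.edgeFinset \ B₂) ∪
        I.biUnion (fun i => (Finset.Ico (g + 1 + h) (g + 1 + 2 * h)).filter
          (fun j => s(f (i + 1), f (j + 1)) ∉ G.edgeFinset \ B₂)) := by
      intro j hj
      by_cases h1 : s(w, f j) ∈ G.edgeFinset \ B₂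
      · obtain ⟨i, hi, hij⟩ := hcon j hj h1
        exact Finset.mem_union_right _ (Finset.mem_biUnion.2
          ⟨i, hi, Finset.mem_filter.2 ⟨hj, hij⟩⟩)
      · exact Finset.mem_union_left _ (Finset.mem_filter.2 ⟨hj, h1⟩)
    have h2 := (Finset.card_le_card h1).trans (Finset.card_union_le _ _)
    have h3 : ((Finset.Ico (g + 1 + h) (g + 1 + 2 * h)).filter
          (fun j => s(w, f j) ∉ G.edgeFinset \ B₂)).card ≤ r + edgeDegree B₂ w := by
      refine card_filter_blocked_le hr B₂ w ?_
      intro i hi j hj hij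
      simp only [Finset.coe_Ico, Set.mem_Ico] at hi hj
      exact hinj i j (by omega) (by omega) hij
    have h4 : (I.biUnion (fun i => (Finset.Ico (g + 1 + h) (g + 1 + 2 * h)).filter
          (fun j => s(f (i + 1), f (j + 1)) ∉ G.edgeFinset \ B₂))).card ≤
        I.card * (r + (64 * (q + 1) + q * (q + 2))) := by
      refine Finset.card_biUnion_le_card_mul _ _ _ fun i hi => ?_
      refine (card_filter_blocked_le (f := fun j => f (j + 1)) hr B₂ (f (i + 1)) ?_).trans ?_
      · intro i hi j hj hij
        simp only [Finset.coe_Ico, Set.mem_Ico] at hi hj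
        have := hinj (i + 1) (j + 1) (by omega) (by omega) hij
        omega
      · have := hB₂B (f (i + 1))
        have := (Finset.mem_filter.1 (hI hi)).2.2
        omega
    have h5 := hB₂B w
    have h6 : (Finset.Ico (g + 1 + h) (g + 1 + 2 * h)).card = h := by
      rw [Nat.card_Ico]
      omega
    rw [hM₁c] at h4
    have h7 : q * (q + 2) ≤ q * (q + 3) := Nat.mul_le_mul_left q (by omega)
    have h8 : (q + 1) * (r + (64 * (q + 1) + q * (q + 2))) + r =
      (q + 2) * r + (q + 1) * (64 * (q + 1) + q * (q + 2)) := by ring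
    omega
  have hj' := Finset.mem_Ico.1 hj
  refine ⟨_, hwj, ?_⟩
  refine canWin_succ_of_forall_exists fun S₂ _ _ hS₂ => ?_
  obtain ⟨i, hi, hiS⟩ : ∃ i ∈ I, s(f (i + 1), f (j + 1)) ∉ S₂ := by
    by_contra! hcon
    have : I.card ≤ S₂.card := by
      refine Finset.card_le_card_of_injOn (fun i => s(f (i + 1), f (j + 1))) hcon ?_
      intro i hi i' hi' hii
      have h1 := hI₀k i (hI hi)
      have h2 := hI₀k i' (hI hi')
      have := hinj (i + 1) (i' + 1) (by omega) (by omega) (Sym2.congr_left.1 hii)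
      omega
    omega
  have hik := hI₀k i (hI hi)
  have hij := Finset.mem_sdiff.1 (hjI i hi)
  refine ⟨s(f (i + 1), f (j + 1)), ?_, ?_⟩
  · rw [Finset.mem_sdiff, Finset.mem_union, not_or]
    exact ⟨hij.1, hij.2, hiS⟩
  obtain ⟨L₂, P, hL₂, hP₁, hP₂⟩ := hL₁.three_opt hik.1 (by omega : i < j) hv hw (hf i (by omega))
    (hf (i + 1) (by omega)) (hf j (by omega)) (hf (j + 1) (by omega))
  set M₂ := insert s(f (i + 1), f (j + 1)) (insert s(w, f j)
    (M ∪ I.image (fun i => s(v, f i)))) with hM₂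
  have hMM₂ : M ⊆ M₂ := by
    intro e he
    simp [hM₂, he]
  have m₁ : s(v, f i) ∈ M₂ := by
    refine Finset.mem_insert_of_mem (Finset.mem_insert_of_mem (Finset.mem_union_right _ ?_))
    exact Finset.mem_image_of_mem (fun i => s(v, f i)) hi
  have m₂ : s(w, f j) ∈ M₂ := by simp [hM₂]
  have m₃ : s(f (i + 1), f (j + 1)) ∈ M₂ := by simp [hM₂]
  have hcard : (B₁ ∪ S₁ ∪ S₂).card ≤ q * (q + 3) := by
    have h1 := Finset.card_union_le (B₁ ∪ S₁) S₂
    have h2 := Finset.card_union_le B₁ S₁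
    linarith
  have hBeq : B₂ ∪ S₂ = B ∪ (B₁ ∪ S₁ ∪ S₂) := by
    simp only [hB₂, Finset.union_assoc]
  refine hwin L₂ M₂ (B₂ ∪ S₂) hL₂ ?_ (card_gaps_lt hP₁ hP₂ hMM₂ hvw m₁ m₂ m₃)
    (fun e he => mem_gaps_of_mem_gaps hP₁ hP₂ hMM₂ m₁ m₂ m₃ he) ?_ ?_
  · refine Finset.insert_subset hij.1 (Finset.insert_subset (Finset.mem_sdiff.1 hwj).1 ?_)
    exact Finset.union_subset hM hM₁E
  · rw [hBeq]
    exact (Finset.card_union_le _ _).trans (Nat.add_le_add_left hcard _)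
  · intro z
    rw [hBeq]
    exact (edgeDegree_union_le _ _ z).trans (Nat.add_le_add_left hcard _)

end CloseGap

/-! ### The strategy -/

section Strategy

variable {V : Type*} [Fintype V] [DecidableEq V] {a b : V} {G : SimpleGraph V} [DecidableRel G.Adj]
  {r : ℕ}

/-- Maker closes `n` gaps one after the other. Breaker claims at most `n * (q * (q + 3))` edges
meanwhile, which keeps his degree at each gap endpoint at most `D`. -/
theorem canWin_of_few_gaps (hr : ∀ v, Fintype.card V ≤ G.degree v + r) {q D h : ℕ}
    (hh : 4 * h + 2 ≤ Fintype.card V)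
    (hh₁ : 16 * ((q + 1) * (q + 1) + r + D) + Fintype.card V ≤ 16 * h)
    (hh₂ : (q + 2) * r + D + (q + 1) * (64 * (q + 1) + q * (q + 2)) < h) (n : ℕ)
    {L : List V} (hL : IsTour a b L) {M B : Finset (Sym2 V)} (hM : M ⊆ G.edgeFinset)
    (hn : (gaps L M).card ≤ n)
    (hD : ∀ e ∈ gaps L M, ∀ z ∈ e, edgeDegree B z + n * (q * (q + 3)) ≤ D)
    (hB : B.card + n * (q * (q + 3)) ≤ 2 * (q * Fintype.card V)) :
    CanWin G.edgeFinset (hamPathSets G a b) q (n * (q + 3)) M B := by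
  induction n generalizing L M B with
  | zero =>
    obtain ⟨W, hW, hWM⟩ := hL.exists_hamPathSet G
      (fun e he => SimpleGraph.mem_edgeFinset.1 (hM he)) (M := M)
      (Multiset.card_eq_zero.1 (Nat.le_zero.1 hn))
    exact canWin_of_subset hW hWM _ _
  | succ n ih =>
    have e1 : (n + 1) * (q * (q + 3)) = n * (q * (q + 3)) + q * (q + 3) := by ring
    by_cases h0 : gaps L M = 0
    · obtain ⟨W, hW, hWM⟩ := hL.exists_hamPathSet G
        (fun e he => SimpleGraph.mem_edgeFinset.1 (hM he)) (M := M) h0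
      exact canWin_of_subset hW hWM _ _
    · obtain ⟨e, he⟩ := Multiset.exists_mem_of_ne_zero h0
      rw [add_mul, one_mul]
      refine canWin_of_close_gap hr hh hh₁ hh₂ hL hM he (fun z hz => ?_) (by omega) ?_
      · have := hD e he z hz
        omega
      · intro L' M' B' hL' hM' hc hs hB' hdeg
        refine ih hL' hM' (by omega) (fun e' he' z hz => ?_) (by omega)
        have h1 := hD e' (hs e' he') z hz
        have h2 := hdeg z
        omega

/-- The edges in `M` with an endpoint of degree at least `d` in `B`. When `M` and `B` are the edges
of Maker and Breaker, their number bounds the number of moves that Maker has made at vertices where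
Breaker had degree at least `d`. -/
def heavyEdges (d : ℕ) (M B : Finset (Sym2 V)) : Finset (Sym2 V) :=
  M.filter (fun e => ∃ v ∈ e, d ≤ edgeDegree B v)

lemma card_heavyEdges_le {L : List V} (hL : L.Nodup) {M B : Finset (Sym2 V)}
    (hM : ∀ e ∈ M, e ∈ pairs L) {d N : ℕ} (hd : 0 < d) (hN : 4 * B.card ≤ N * d) :
    (heavyEdges d M B).card ≤ N := by
  have h1 : heavyEdges d M B ⊆
      (Finset.univ.filter (d ≤ edgeDegree B ·)).biUnion (fun v => M.filter (v ∈ ·)) := by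
    intro e he
    obtain ⟨heM, v, hv, hd⟩ := Finset.mem_filter.1 he
    simp only [Finset.mem_biUnion, Finset.mem_filter, Finset.mem_univ, true_and]
    exact ⟨v, hd, heM, hv⟩
  have h2 := (Finset.card_le_card h1).trans
    (Finset.card_biUnion_le_card_mul _ _ 2 fun v _ => card_filter_mem_le_two hL hM v)
  have h3 := mul_card_heavy_le B d
  refine Nat.le_of_mul_le_mul_right (?_ : _ * d ≤ _ * d) hd
  nlinarith

/-- If `v` is an endpoint of a gap, and there are more gaps than obstructions at `v`, then a free
edge from `v` reduces the number of gaps. It is never an edge of `M`, since `M` contains only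
consecutive pairs of the tour. -/
lemma IsTour.exists_join {L : List V} (hL : IsTour a b L)
    (hr : ∀ v, Fintype.card V ≤ G.degree v + r) {M B : Finset (Sym2 V)}
    (hM : ∀ e ∈ M, e ∈ pairs L) {e : Sym2 V} (he : e ∈ gaps L M) {v : V} (hv : v ∈ e)
    (hc : r + edgeDegree B v + 1 < (gaps L M).card) :
    ∃ u L', s(v, u) ∈ G.edgeFinset \ B ∧ s(v, u) ∉ M ∧ IsTour a b L' ∧
      (∀ e ∈ insert s(v, u) M, e ∈ pairs L') ∧
      (gaps L' (insert s(v, u) M)).card < (gaps L M).card ∧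
      ∀ e ∈ gaps L' (insert s(v, u) M), ∀ z ∈ e, ∃ e' ∈ gaps L M, z ∈ e' := by
  obtain ⟨L₁, i, w, hL₁, hp₁, hv, hw, hvw⟩ := hL.exists_gap_right he hv
  have hg₁ : gaps L₁ M = gaps L M := by rw [gaps, gaps, hp₁]
  rw [← hg₁] at hc ⊢
  rw [← hp₁] at hM
  obtain ⟨u, huU, hu⟩ : ∃ u ∈ (leftEnds M L₁).toFinset.erase v, s(v, u) ∈ G.edgeFinset \ B := by
    by_contra! hcon
    have h1 := card_filter_blocked_le hr B v
      (I := (leftEnds M L₁).toFinset.erase v) (f := id) Function.injective_id.injOn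
    rw [Finset.filter_true_of_mem (by simpa using hcon)] at h1
    have h2 := Finset.pred_card_le_card_erase (s := (leftEnds M L₁).toFinset) (a := v)
    rw [List.toFinset_card_of_nodup (hL₁.nodup.sublist (leftEnds_sublist M L₁)),
      length_leftEnds] at h2
    omega
  obtain ⟨huv, hu'⟩ := Finset.mem_erase.1 huU
  obtain ⟨j, w', hj, hw', hjM⟩ := exists_of_mem_leftEnds (List.mem_toFinset.1 hu')
  have hij : i ≠ j := by
    rintro rfl
    rw [hv] at hj
    exact huv (Option.some.inj hj).symm
  have hnew : s(v, u) ∉ M := by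
    intro hvu
    obtain ⟨l, x, y, hx, hy, hxy⟩ := exists_of_mem_pairs (hM _ hvu)
    rcases Sym2.eq_iff.1 hxy with ⟨rfl, rfl⟩ | ⟨rfl, rfl⟩
    · obtain rfl := eq_of_getElem?_eq_some hL₁.nodup hv hx
      rw [hw, Option.some.injEq] at hy
      subst hy
      exact hvw hvu
    · obtain rfl := eq_of_getElem?_eq_some hL₁.nodup hj hx
      rw [hw', Option.some.injEq] at hy
      subst hy
      rw [Sym2.eq_swap] at hvu
      exact hjM hvu
  obtain ⟨L', P, hL', hP, hP'⟩ := hL₁.two_opt hij hv hw hj hw'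
  refine ⟨u, L', hu, hnew, hL', ?_, ?_, ?_⟩
  · intro e he
    rw [hP']
    rcases Finset.mem_insert.1 he with rfl | he
    · simp
    · have := hM e he
      rw [hP, Multiset.mem_add] at this
      refine Multiset.mem_add.2 (.inl (this.resolve_right fun h => ?_))
      simp only [Multiset.insert_eq_cons, Multiset.mem_cons, Multiset.mem_singleton] at h
      rcases h with rfl | rfl <;> contradiction
  · have h := card_filter_notMem_anti (P := P) (Finset.subset_insert s(v, u) M)
    have h1 : (gaps L' (insert s(v, u) M)).card ≤
        (P.filter (· ∉ insert s(v, u) M)).card + 1 := by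
      rw [gaps, hP', Multiset.filter_add, Multiset.card_add, Multiset.insert_eq_cons,
        Multiset.filter_cons_of_neg (p := (· ∉ insert s(v, u) M)) _ (by simp)]
      exact Nat.add_le_add_left ((Multiset.card_le_card (Multiset.filter_le _ _)).trans (by simp)) _
    have h2 : (gaps L₁ M).card = (P.filter (· ∉ M)).card + 2 := by
      rw [gaps, hP, Multiset.filter_add, Multiset.card_add, Multiset.insert_eq_cons,
        Multiset.filter_cons_of_pos (p := (· ∉ M)) _ hvw, Multiset.filter_singleton]
      simp [hjM]
    omega
  · intro e he z hz
    obtain ⟨heL, heM⟩ := mem_gaps.1 he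
    rw [Finset.mem_insert, not_or] at heM
    have g₁ : s(v, w) ∈ gaps L₁ M := mem_gaps.2 ⟨by simp [hP], hvw⟩
    have g₂ : s(u, w') ∈ gaps L₁ M := mem_gaps.2 ⟨by simp [hP], hjM⟩
    rw [hP', Multiset.mem_add] at heL
    rcases heL with heL | heL
    · exact ⟨e, mem_gaps.2 ⟨by rw [hP]; exact Multiset.mem_add.2 (.inl heL), heM.2⟩, hz⟩
    · simp only [Multiset.insert_eq_cons, Multiset.mem_cons, Multiset.mem_singleton] at heL
      rcases heL with rfl | rfl
      · exact absurd rfl heM.1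
      · rcases Sym2.mem_iff.1 hz with rfl | rfl
        · exact ⟨_, g₁, by simp⟩
        · exact ⟨_, g₂, by simp⟩

/-- Maker reduces the number of gaps by one per round until only `m` are left, and then closes
these. The number of his `heavyEdges` serves as a clock: Breaker's degree at a gap endpoint exceeds `d`
by at most `q` for each of them. -/
theorem canWin_of_many_gaps (hr : ∀ v, Fintype.card V ≤ G.degree v + r) {q D h m d N : ℕ}
    (hh : 4 * h + 2 ≤ Fintype.card V)
    (hh₁ : 16 * ((q + 1) * (q + 1) + r + D) + Fintype.card V ≤ 16 * h)
    (hh₂ : (q + 2) * r + D + (q + 1) * (64 * (q + 1) + q * (q + 2)) < h)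
    (hD : d + q * N + m * (q * (q + 3)) ≤ D) (hm : r + d + q * (N + 1) + 1 ≤ m)
    (hd : 0 < d) (hN : 4 * (q * Fintype.card V) ≤ N * d) (hmk : m * (q + 3) ≤ Fintype.card V)
    (n : ℕ) {L : List V} (hL : IsTour a b L) {M B : Finset (Sym2 V)} (hM : M ⊆ G.edgeFinset)
    (hML : ∀ e ∈ M, e ∈ pairs L) (hn : (gaps L M).card ≤ n + m)
    (hB : B.card + q * n ≤ q * Fintype.card V)
    (hdeg : ∀ e ∈ gaps L M, ∀ z ∈ e, edgeDegree B z ≤ d + q * (heavyEdges d M B).card) :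
    CanWin G.edgeFinset (hamPathSets G a b) q (n + m * (q + 3)) M B := by
  induction n generalizing L M B with
  | zero =>
    rw [zero_add] at hn ⊢
    have hΦ := card_heavyEdges_le (B := B) (d := d) (N := N) hL.nodup hML hd (by omega)
    refine canWin_of_few_gaps hr hh hh₁ hh₂ m hL hM hn (fun e he z hz => ?_) ?_
    · have h1 := hdeg e he z hz
      have h2 := Nat.mul_le_mul_left q hΦ
      omega
    · have : m * (q * (q + 3)) ≤ q * Fintype.card V := by
        calc m * (q * (q + 3)) = q * (m * (q + 3)) := by ring
          _ ≤ _ := Nat.mul_le_mul_left q hmk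
      omega
  | succ n ih =>
    have e1 : q * (n + 1) = q * n + q := by ring
    by_cases hfew : (gaps L M).card ≤ n + m
    · exact (ih hL hM hML hfew (by omega) hdeg).mono (by omega)
    rw [show n + 1 + m * (q + 3) = (n + m * (q + 3)) + 1 by ring]
    refine canWin_succ_of_forall_exists fun S _ _ hS => ?_
    have hΦ := card_heavyEdges_le (B := B) (d := d) (N := N) hL.nodup hML hd (by omega)
    have hΦS : (heavyEdges d M B).card ≤ (heavyEdges d M (B ∪ S)).card := by
      refine Finset.card_le_card fun e he => ?_
      obtain ⟨heM, v, hv, hvd⟩ := Finset.mem_filter.1 he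
      exact Finset.mem_filter.2
        ⟨heM, v, hv, hvd.trans (edgeDegree_mono Finset.subset_union_left v)⟩
    have hdegS : ∀ e ∈ gaps L M, ∀ z ∈ e,
        edgeDegree (B ∪ S) z ≤ d + q * ((heavyEdges d M B).card + 1) := by
      intro e he z hz
      have h1 := hdeg e he z hz
      have h2 := edgeDegree_union_le B S z
      rw [mul_add, mul_one]
      omega
    -- A gap endpoint of Breaker degree at least `d` if there is one, any gap endpoint otherwise.
    obtain ⟨e, he, v, hv, hsel⟩ : ∃ e ∈ gaps L M, ∃ v ∈ e, d ≤ edgeDegree (B ∪ S) v ∨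
        ∀ e' ∈ gaps L M, ∀ z ∈ e', edgeDegree (B ∪ S) z ≤ d := by
      by_cases hex : ∃ e ∈ gaps L M, ∃ v ∈ e, d ≤ edgeDegree (B ∪ S) v
      · obtain ⟨e, he, v, hv, hvd⟩ := hex
        exact ⟨e, he, v, hv, .inl hvd⟩
      · push Not at hex
        have h0 : gaps L M ≠ 0 := fun h0 => by simp [h0] at hfew
        obtain ⟨e, he⟩ := Multiset.exists_mem_of_ne_zero h0
        induction e with
        | _ x y => exact ⟨_, he, x, by simp, .inr fun e' he' z hz => (hex e' he' z hz).le⟩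
    have hvdeg : edgeDegree (B ∪ S) v ≤ d + q * (N + 1) :=
      (hdegS e he v hv).trans
        (Nat.add_le_add_left (Nat.mul_le_mul_left q (Nat.add_le_add_right hΦ 1)) d)
    obtain ⟨u, L', hu, hnew, hL', hML', hlt, hends⟩ :=
      hL.exists_join hr hML he hv (B := B ∪ S) (by omega)
    refine ⟨s(v, u), hu, ih hL' (Finset.insert_subset (Finset.mem_sdiff.1 hu).1 hM) hML'
      (by omega) ?_ ?_⟩
    · have := Finset.card_union_le B S
      omega
    · intro e' he' z hz
      obtain ⟨e'', he'', hz''⟩ := hends e' he' z hz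
      rcases hsel with hvd | hall
      · have h1 : (heavyEdges d M (B ∪ S)).card + 1 ≤
            (heavyEdges d (insert s(v, u) M) (B ∪ S)).card := by
          have : heavyEdges d (insert s(v, u) M) (B ∪ S) =
              insert s(v, u) (heavyEdges d M (B ∪ S)) := by
            rw [heavyEdges, Finset.filter_insert, if_pos ⟨v, by simp, hvd⟩]
            rfl
          rw [this, Finset.card_insert_of_notMem]
          exact fun hmem => hnew (Finset.mem_filter.1 hmem).1
        exact (hdegS e'' he'' z hz'').trans
          (Nat.add_le_add_left (Nat.mul_le_mul_left q (by omega)) d)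
      · exact (hall e'' he'' z hz'').trans (Nat.le_add_right _ _)

/-- The result for fixed parameters: `r` bounds the number of non-neighbours of a vertex, `m` is the
number of gaps at which Maker passes to closing gaps in `q + 3` rounds each, `d` is the Breaker
degree from which a vertex is served first, `N` bounds the number of `heavyEdges`, and `D` bounds the Breaker
degree of gap endpoints throughout. -/
theorem makerWinsWithin_hamPathSets (hr : ∀ v, Fintype.card V ≤ G.degree v + r)
    {q D h m d N : ℕ} (hh : 4 * h + 2 ≤ Fintype.card V)
    (hh₁ : 16 * ((q + 1) * (q + 1) + r + D) + Fintype.card V ≤ 16 * h)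
    (hh₂ : (q + 2) * r + D + (q + 1) * (64 * (q + 1) + q * (q + 2)) < h)
    (hD : d + q * N + m * (q * (q + 3)) ≤ D) (hm : r + d + q * (N + 1) + 1 ≤ m)
    (hd : 0 < d) (hN : 4 * (q * Fintype.card V) ≤ N * d) (hmk : m * (q + 3) ≤ Fintype.card V)
    (hab : a ≠ b) :
    MakerWinsWithin G.edgeFinset (hamPathSets G a b) 1 q (Fintype.card V + m * (q + 3)) := by
  obtain ⟨L, hL⟩ := exists_isTour hab
  refine makerWinsWithin_of_canWin
    (canWin_of_many_gaps hr hh hh₁ hh₂ hD hm hd hN hmk _ hL (by simp) (by simp) ?_ (by simp) ?_)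
  · have h1 : (gaps L ∅).card ≤ L.length := by
      refine (Multiset.card_le_card (Multiset.filter_le _ _)).trans ?_
      rw [card_pairs]
      omega
    rw [hL.length_eq] at h1
    omega
  · intro e _ z _
    simp [edgeDegree]

end Strategy

/-! ### Sequences bounded by a power -/

section Asymptotics

/-- `f k = O(k ^ s)`, for a sequence of natural numbers. -/
def PolyBound (s : ℝ) (f : ℕ → ℕ) : Prop :=
  (fun k => (f k : ℝ)) =O[Filter.atTop] fun k : ℕ => (k : ℝ) ^ s

variable {s t : ℝ} {f g : ℕ → ℕ}

lemma PolyBound.mono (h : PolyBound s f) (hst : s ≤ t) : PolyBound t f := by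
  refine h.trans (IsBigO.of_bound 1 ?_)
  filter_upwards [Filter.eventually_ge_atTop 1] with k hk
  have hk' : (1 : ℝ) ≤ k := by exact_mod_cast hk
  rw [Real.norm_of_nonneg (by positivity), Real.norm_of_nonneg (by positivity), one_mul]
  exact Real.rpow_le_rpow_of_exponent_le hk' hst

lemma PolyBound.add (hf : PolyBound s f) (hg : PolyBound s g) :
    PolyBound s (fun k => f k + g k) := by
  simpa [PolyBound] using IsBigO.add hf hg

lemma PolyBound.mul (hf : PolyBound s f) (hg : PolyBound t g) :
    PolyBound (s + t) (fun k => f k * g k) := by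
  refine IsBigO.trans (by simpa [PolyBound] using IsBigO.mul hf hg) (IsBigO.of_bound 1 ?_)
  filter_upwards [Filter.eventually_ge_atTop 1] with k hk
  have hk' : (0 : ℝ) < k := by exact_mod_cast hk
  rw [Real.rpow_add hk', one_mul]

lemma polyBound_const (c : ℕ) (hs : 0 ≤ s) : PolyBound s (fun _ => c) := by
  refine PolyBound.mono (s := 0) ?_ hs
  simpa [PolyBound] using isBigO_const_const (c : ℝ) (one_ne_zero (α := ℝ)) Filter.atTop

lemma polyBound_floor (s : ℝ) : PolyBound s (fun k => ⌊(k : ℝ) ^ s⌋₊) := by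
  refine IsBigO.of_bound 1 (Filter.Eventually.of_forall fun k => ?_)
  have h : (0 : ℝ) ≤ (k : ℝ) ^ s := by positivity
  rw [Real.norm_of_nonneg (by positivity), Real.norm_of_nonneg h, one_mul]
  exact Nat.floor_le h

lemma polyBound_ceil (c : ℕ) (hs : 0 ≤ s) : PolyBound s (fun k => ⌈c * (k : ℝ) ^ s⌉₊) := by
  refine IsBigO.of_bound (c + 1) ?_
  filter_upwards [Filter.eventually_ge_atTop 1] with k hk
  have hk' : (1 : ℝ) ≤ k := by exact_mod_cast hk
  have h := Real.one_le_rpow hk' hs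
  rw [Real.norm_of_nonneg (by positivity), Real.norm_of_nonneg (by positivity)]
  have := (Nat.ceil_lt_add_one (by positivity : 0 ≤ c * (k : ℝ) ^ s)).le
  linarith

lemma PolyBound.isLittleO (h : PolyBound s f) (hs : s < 1) :
    (fun k => (f k : ℝ)) =o[Filter.atTop] fun k : ℕ => (k : ℝ) := by
  refine IsBigO.trans_isLittleO h ?_
  have h₁ : (fun x : ℝ => x ^ s) =o[Filter.atTop] fun x : ℝ => x ^ (1 : ℝ) := by
    refine isLittleO_of_tendsto' ?_ ?_
    · filter_upwards [Filter.eventually_gt_atTop 0] with x hx h0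
      rw [Real.rpow_one] at h0
      exact absurd h0 hx.ne'
    · refine (tendsto_rpow_neg_atTop (sub_pos.2 hs)).congr' ?_
      filter_upwards [Filter.eventually_gt_atTop 0] with x hx
      rw [← Real.rpow_sub hx, neg_sub]
  simpa [Function.comp_def] using h₁.comp_tendsto tendsto_natCast_atTop_atTop

end Asymptotics

end MakerBreaker

theorem lemma3p3 (β γ : ℝ) (hβ : 0 < β) (hγ : 0 < γ) (hγ' : γ < 1 / 8) (hβγ : β + 2 * γ < 1) :
    ∃ f : ℕ → ℝ, (f =o[Filter.atTop] fun k : ℕ => (k : ℝ)) ∧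
      ∃ k₀ : ℕ, ∀ k : ℕ, k₀ ≤ k → ∀ q : ℕ, (q : ℝ) ≤ (k : ℝ) ^ γ →
        ∀ (V : Type*) [Fintype V] [DecidableEq V] (G : SimpleGraph V) [DecidableRel G.Adj],
          Fintype.card V = k → (k : ℝ) - (k : ℝ) ^ β ≤ (G.minDegree : ℝ) →
            ∀ a b : V, a ≠ b →
              ∃ t : ℕ, (t : ℝ) ≤ (k : ℝ) + f k ∧
                MakerBreaker.MakerWinsWithin G.edgeFinset (MakerBreaker.hamPathSets G a b) 1 q t := by
  open MakerBreaker in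
  -- Bounds that depend on `k` only: `Q` for the bias, `R` for the number of non-neighbours. `T`
  -- collects all the quantities that have to be small compared with `k`.
  let Q : ℕ → ℕ := fun k => ⌊(k : ℝ) ^ γ⌋₊
  let R : ℕ → ℕ := fun k => ⌊(k : ℝ) ^ β⌋₊
  let d : ℕ → ℕ := fun k => ⌈(1 : ℕ) * (k : ℝ) ^ (1 - 3 * γ)⌉₊
  let N : ℕ → ℕ := fun k => ⌈(4 : ℕ) * (k : ℝ) ^ (4 * γ)⌉₊
  let m : ℕ → ℕ := fun k => R k + d k + Q k * (N k + 1) + 1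
  let D : ℕ → ℕ := fun k => d k + Q k * N k + m k * (Q k * (Q k + 3))
  let T : ℕ → ℕ := fun k => (Q k + 1) * (Q k + 1) + R k + D k + ((Q k + 2) * R k +
    (Q k + 1) * (64 * (Q k + 1) + Q k * (Q k + 2))) + m k * (Q k + 3)
  -- `σ` is an exponent for the number `m` of gaps left to the second stage; `Q * N`, of order
  -- `k ^ (5 * γ)`, is within it because `γ < 1 / 8`.
  obtain ⟨σ, hσβ, hσγ, hσ⟩ : ∃ σ, β ≤ σ ∧ 1 - 3 * γ ≤ σ ∧ σ + 2 * γ < 1 :=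
    ⟨max β (1 - 3 * γ), le_max_left _ _, le_max_right _ _, by
      rw [← lt_sub_iff_add_lt]; exact max_lt (by linarith) (by linarith)⟩
  have bQ : PolyBound γ Q := polyBound_floor γ
  have bQc (c : ℕ) : PolyBound γ (fun k => Q k + c) := bQ.add (polyBound_const c hγ.le)
  have bR : PolyBound σ R := (polyBound_floor β).mono hσβ
  have bd : PolyBound σ d := (polyBound_ceil 1 (by linarith)).mono hσγ
  have bN : PolyBound (4 * γ) N := polyBound_ceil 4 (by linarith)
  have bQN : PolyBound σ (fun k => Q k * N k) := (bQ.mul bN).mono (by linarith)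
  have bm : PolyBound σ m :=
    ((bR.add bd).add ((bQ.mul (bN.add (polyBound_const 1 (by linarith)))).mono
      (by linarith))).add (polyBound_const 1 (by linarith))
  have bD : PolyBound (σ + 2 * γ) D :=
    ((bd.add bQN).mono (by linarith)).add ((bm.mul (bQ.mul (bQc 3))).mono (by linarith))
  have bT : PolyBound (σ + 2 * γ) T := by
    refine (((PolyBound.add ?_ ?_).add bD).add (PolyBound.add ?_ ?_)).add ?_
    · exact ((bQc 1).mul (bQc 1)).mono (by linarith)
    · exact bR.mono (by linarith)
    · exact ((bQc 2).mul bR).mono (by linarith)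
    · refine ((bQc 1).mul (PolyBound.add (s := 2 * γ) ?_ ?_)).mono (by linarith)
      · exact ((polyBound_const 64 le_rfl).mul (bQc 1)).mono (by linarith)
      · exact (bQ.mul (bQc 2)).mono (by linarith)
    · exact (bm.mul (bQc 3)).mono (by linarith)
  have hT : ∀ᶠ k : ℕ in Filter.atTop, 16 * T k ≤ k := by
    filter_upwards [(bT.isLittleO hσ).bound (show (0 : ℝ) < 1 / 16 by norm_num)] with k hk
    rw [Real.norm_of_nonneg (by positivity), Real.norm_of_nonneg (by positivity)] at hk
    have : (16 : ℝ) * T k ≤ k := by linarith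
    exact_mod_cast this
  obtain ⟨k₀, hk₀⟩ := Filter.eventually_atTop.1 hT
  refine ⟨fun k => ((m k * (Q k + 3) : ℕ) : ℝ),
    ((bm.mul (bQc 3)).mono (t := σ + 2 * γ) (by linarith)).isLittleO hσ, max k₀ 10, ?_⟩
  intro k hk q hq V _ _ G _ hcard hdeg a b hab
  have hk10 : 10 ≤ k := (le_max_right _ _).trans hk
  have hTk := hk₀ k ((le_max_left _ _).trans hk)
  have hkpos : (0 : ℝ) < k := by exact_mod_cast (by omega : 0 < k)
  have hqQ : q ≤ Q k := Nat.le_floor hq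
  have hr : ∀ v, Fintype.card V ≤ G.degree v + R k := by
    intro v
    rw [hcard]
    have h1 : G.minDegree ≤ G.degree v := G.minDegree_le_degree v
    have h2 : k - G.minDegree ≤ R k := by
      refine Nat.le_floor ?_
      rcases le_total k G.minDegree with h | h
      · rw [Nat.sub_eq_zero_of_le h]
        simpa using (Real.rpow_pos_of_pos hkpos β).le
      · rw [Nat.cast_sub h]
        linarith
    omega
  have hd : 0 < d k := Nat.ceil_pos.2 (by positivity)
  have hN : 4 * (q * k) ≤ N k * d k := by
    have h1 : (4 : ℝ) * (k : ℝ) ^ (4 * γ) ≤ N k := Nat.le_ceil _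
    have h2 : (k : ℝ) ^ (1 - 3 * γ) ≤ d k := by
      refine le_trans ?_ (Nat.le_ceil _)
      rw [Nat.cast_one, one_mul]
    have h3 : (k : ℝ) ^ (4 * γ) * (k : ℝ) ^ (1 - 3 * γ) = (k : ℝ) ^ γ * k := by
      rw [← Real.rpow_add hkpos, ← Real.rpow_add_one hkpos.ne']
      congr 1
      ring
    have h4 : (4 : ℝ) * (q * k) ≤ N k * d k := by
      calc (4 : ℝ) * (q * k) ≤ 4 * ((k : ℝ) ^ γ * k) := by gcongr
        _ = (4 * (k : ℝ) ^ (4 * γ)) * (k : ℝ) ^ (1 - 3 * γ) := by rw [← h3]; ring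
        _ ≤ _ := by gcongr
    exact_mod_cast h4
  have i₁ : (q + 1) * (q + 1) ≤ (Q k + 1) * (Q k + 1) := by gcongr
  have i₂ : (q + 2) * R k ≤ (Q k + 2) * R k := by gcongr
  have i₃ : (q + 1) * (64 * (q + 1) + q * (q + 2)) ≤
    (Q k + 1) * (64 * (Q k + 1) + Q k * (Q k + 2)) := by gcongr
  have i₄ : m k * (q + 3) ≤ m k * (Q k + 3) := by gcongr
  have hTdef : T k = (Q k + 1) * (Q k + 1) + R k + D k + ((Q k + 2) * R k +
    (Q k + 1) * (64 * (Q k + 1) + Q k * (Q k + 2))) + m k * (Q k + 3) := rfl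
  refine ⟨k + m k * (q + 3), ?_, ?_⟩
  · have : k + m k * (q + 3) ≤ k + m k * (Q k + 3) := by omega
    rw [← Nat.cast_add]
    exact Nat.cast_le.2 this
  · have key := makerWinsWithin_hamPathSets (q := q) (r := R k) (D := D k) (h := (k - 2) / 4)
      (m := m k) (d := d k) (N := N k) hr (by omega) (by omega) (by omega) ?_ ?_ hd
      (by rwa [hcard]) (by omega) hab
    · rwa [hcard] at key
    · show _ ≤ d k + Q k * N k + m k * (Q k * (Q k + 3))
      gcongr
    · show _ ≤ R k + d k + Q k * (N k + 1) + 1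
      gcongr
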